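/- For $n\ge 0$ let $\mathcal M_n$ be the set of Motzkin paths of length $n$, i.e. of sequences $\gamma_n=(\varepsilon_1,\dots,\varepsilon_n)\in\{-1,0,1\}^n$ with $\varepsilon_1+\dots+\varepsilon_k\ge 0$ for all $0\le k\le n$ and $\varepsilon_1+\dots+\varepsilon_n=0$. For such a path put $\varepsilon_j^+=1$ if $\varepsilon_j=1$ (step $j$ is an ascent) and $\varepsilon_j^+=0$ otherwise, and $\delta_j=1$ if $\varepsilon_j=0$ (step $j$ is a level step) and $\delta_j=0$ otherwise. Let $(Z_t)_{t\ge 0}$ be the free Brownian motion, understood as a classical real-valued Markov process: $Z_0=0$ almost surely; for $t>0$ the law of $Z_t$ has the density $$p_t(x)=\frac{\sqrt{4t-x^2}}{2\pi t}\,1_{\{|x|\le 2\sqrt t\}};$$ and for $0\le s<t$ and every Borel set $B\subset\mathbb R$, almost surely $$P(Z_t\in B\mid Z_r,\ r\le s)=\int_B p_{s,t}(Z_s,y)\,dy,$$ where $$p_{s,t}(x,y)=\frac1{2\pi}\,\frac{(t-s)\sqrt{4t-y^2}}{t x^2+s y^2-(s+t)xy+(t-s)^2}\qquad\text{for } |x|\le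 2\sqrt s,\ |y|\le 2\sqrt t,$$ and $p_{s,t}(x,y)=0$ otherwise. Then for all real $0<t_1\le t_2\le\dots\le t_n$ and all real $u_1,\dots,u_n$, the random variable $\prod_{j=1}^n(u_j+Z_{t_j})$ is integrable and $$\sum_{\gamma_n\in\mathcal M_n}\ \prod_{j=1}^n t_j^{\varepsilon_j^+}\prod_{j=1}^n u_j^{\delta_j}=E\left(\prod_{j=1}^n\left(u_j+Z_{t_j}\right)\right),$$ where $0^0=1$. -/

import Mathlib

open MeasureTheory ProbabilityTheory
open scoped NNReal

/-- The set of Motzkin paths of length `n`. A path from `(0, 0)` to `(n, 0)` is recorded by its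
vertical increments `ε j ∈ {-1, 0, 1}` (descent, level step, ascent); its height after `k` steps
is the sum of the first `k` increments, which must be nonnegative for every `k ≤ n`, and the final
height must be `0`. -/
def motzkinPaths (n : ℕ) : Finset (Fin n → ℤ) :=
  {ε ∈ Fintype.piFinset fun _ : Fin n => ({-1, 0, 1} : Finset ℤ) |
    (∀ k : Fin (n + 1), 0 ≤ ∑ j : Fin n with j.val < k.val, ε j) ∧ ∑ j, ε j = 0}

/-- The density of the centred semicircle law of variance `t > 0`. -/
noncomputable def semicircleDensity (t x : ℝ) : ℝ :=
  if |x| ≤ 2 * √t then √(4 * t - x ^ 2) / (2 * Real.pi * t) else 0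

/-- The transition density `p_{s,t}(x, y)` of the free Brownian motion, for `0 ≤ s < t`. It is
given by the formula for `|x| ≤ 2√s` and `|y| ≤ 2√t`, and vanishes elsewhere. -/
noncomputable def freeTransitionDensity (s t x y : ℝ) : ℝ :=
  if |x| ≤ 2 * √s ∧ |y| ≤ 2 * √t then
    1 / (2 * Real.pi) *
      ((t - s) * √(4 * t - y ^ 2) /
        (t * x ^ 2 + s * y ^ 2 - (s + t) * x * y + (t - s) ^ 2))
  else 0

/-- `Z` is a free Brownian motion under `P`, in the sense of classical probability: a real process
started at `0`, with semicircle marginals, which is Markov (with respect to the filtration that it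
generates) with the transition probabilities
`P(Z t ∈ B | Z r, r ≤ s) = ∫ y in B, p_{s,t}(Z s, y)` for `0 ≤ s < t`. -/
structure IsFreeBrownianMotion {Ω : Type*} [MeasurableSpace Ω]
    (Z : ℝ≥0 → Ω → ℝ) (P : Measure Ω) : Prop where
  measurable : ∀ t, Measurable (Z t)
  start : ∀ᵐ ω ∂P, Z 0 ω = 0
  marginal : ∀ t : ℝ≥0, 0 < t →
    P.map (Z t) = volume.withDensity fun x => ENNReal.ofReal (semicircleDensity t x)
  markov : ∀ s t : ℝ≥0, s < t → ∀ B : Set ℝ, MeasurableSet B →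
    P[(Z t ⁻¹' B).indicator (fun _ => (1 : ℝ)) |
        ⨆ r : ℝ≥0, ⨆ _ : r ≤ s, MeasurableSpace.comap (Z r) inferInstance]
      =ᵐ[P] fun ω => ∫ y in B, freeTransitionDensity s t (Z s ω) y

/-!
The polynomials `b_k` orthogonal for the semicircle law of variance `t` (`freeChebyshev t`) satisfy
`x * b_k = b_{k+1} + t * b_{k-1}`, so multiplication by `u + x` moves the index `k` as a lattice
path moves its height, seen backwards in time: an index raised by one, with weight `1`, is a
descent; an index kept, with weight `u`, is a level step; an index lowered by one, with weight `t`,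
is an ascent. What makes this usable at several times is that `b_k` taken at time `t` and evaluated
at `Z t` is a martingale (`IsFreeBrownianMotion.condExp_freeChebyshev`). In
`E (∏ j, (u j + Z (t j)) * b_k (Z T))` one may therefore replace `T` by the last of the times `t j`,
absorb the last factor by the recurrence, and go on; once all factors are absorbed, the
expectation of `b_k` vanishes unless `k = 0`. This gives the weighted number of nonnegative paths
from height `0` to height `k` (`IsFreeBrownianMotion.integral_prod_mul_freeChebyshev`), and `k = 0`
is the claim.

The martingale property rests on the expansion
`p_{s,t}(x, y) = ρ_t(y) * ∑ k, a_k(x) * b_k(y) / t ^ k`, where `ρ_t` is the semicircle density and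
`a_k`, `b_k` belong to the times `s`, `t` (`mul_tsum_freeChebyshev_mul`). The series converges
absolutely on the supports because there `|a_k * b_k / t ^ k| ≤ (k + 1) ^ 2 * (√s / √t) ^ k`.
Orthogonality of the `b_k` then turns integration of `b_k` against `p_{s,t}(x, ·)` into evaluation
of `a_k` at `x`. The Markov property, stated for indicator functions, is transferred to polynomials
by identifying the law of `Z t` on each event of the past with the image of the law of `Z s` on
this event under the transition kernel (`IsFreeBrownianMotion.map_restrict_eq_bind`).
-/

/-! ### Orthogonal polynomials of the semicircle law -/

/-- The monic polynomials orthogonal for the semicircle law of variance `t`: rescaled Chebyshev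
polynomials of the second kind, `√t ^ n * U_n (x / (2 * √t))`, given by their three-term
recurrence. -/
def freeChebyshev (t x : ℝ) : ℕ → ℝ
  | 0 => 1
  | 1 => x
  | n + 2 => x * freeChebyshev t x (n + 1) - t * freeChebyshev t x n

lemma freeChebyshev_add_two (t x : ℝ) (n : ℕ) :
    freeChebyshev t x (n + 2) = x * freeChebyshev t x (n + 1) - t * freeChebyshev t x n := by
  rw [freeChebyshev]

lemma continuous_freeChebyshev (t : ℝ) (n : ℕ) : Continuous fun x => freeChebyshev t x n := by
  induction n using Nat.twoStepInduction with
  | zero => simp only [freeChebyshev]; fun_prop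
  | one => simp only [freeChebyshev]; fun_prop
  | more n h₀ h₁ => simp only [freeChebyshev_add_two]; fun_prop

lemma freeChebyshev_eq_eval_U (r c : ℝ) (n : ℕ) :
    freeChebyshev (r ^ 2) (2 * r * c) n = r ^ n * (Polynomial.Chebyshev.U ℝ n).eval c := by
  induction n using Nat.twoStepInduction with
  | zero => simp [freeChebyshev]
  | one => simp [freeChebyshev]; ring
  | more n h₀ h₁ =>
    rw [freeChebyshev_add_two, h₀, h₁]
    push_cast
    rw [Polynomial.Chebyshev.U_add_two]
    simp
    ring

/-- The bound follows from `U (n + 1) = X * U n + T (n + 1)`, which avoids dividing by `sin θ`. -/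
lemma abs_eval_U_cos_le (θ : ℝ) (n : ℕ) :
    |(Polynomial.Chebyshev.U ℝ n).eval (Real.cos θ)| ≤ n + 1 := by
  induction n with
  | zero => simp
  | succ n ih =>
    have h : Polynomial.Chebyshev.U ℝ ((n + 1 : ℕ) : ℤ) =
        Polynomial.X * Polynomial.Chebyshev.U ℝ n + Polynomial.Chebyshev.T ℝ (n + 1) := by
      push_cast
      exact Polynomial.Chebyshev.U_eq_X_mul_U_add_T ℝ n
    rw [h, Polynomial.eval_add, Polynomial.eval_mul, Polynomial.eval_X,
      Polynomial.Chebyshev.T_real_cos]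
    refine (abs_add_le _ _).trans ?_
    rw [abs_mul]
    have := mul_le_mul (Real.abs_cos_le_one θ) ih (abs_nonneg _) zero_le_one
    have := Real.abs_cos_le_one (((n + 1 : ℤ) : ℝ) * θ)
    push_cast at *
    linarith

lemma exists_eq_two_mul_mul_cos {r x : ℝ} (hr : 0 ≤ r) (hx : |x| ≤ 2 * r) :
    ∃ θ, x = 2 * r * Real.cos θ := by
  rcases hr.eq_or_lt with rfl | hr
  · exact ⟨0, by simpa using hx⟩
  · have h := abs_le.mp hx
    refine ⟨Real.arccos (x / (2 * r)), ?_⟩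
    rw [Real.cos_arccos]
    · field_simp
    · rw [le_div_iff₀ (by positivity)]; linarith
    · rw [div_le_iff₀ (by positivity)]; linarith

lemma abs_freeChebyshev_le {t x : ℝ} (ht : 0 ≤ t) (hx : |x| ≤ 2 * √t) (n : ℕ) :
    |freeChebyshev t x n| ≤ (n + 1) * √t ^ n := by
  obtain ⟨θ, rfl⟩ := exists_eq_two_mul_mul_cos (Real.sqrt_nonneg t) hx
  have h := freeChebyshev_eq_eval_U (√t) (Real.cos θ) n
  rw [Real.sq_sqrt ht] at h
  rw [h, abs_mul, abs_of_nonneg (by positivity), mul_comm]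
  gcongr
  exact abs_eval_U_cos_le θ n

/-- The substitution `x = 2√t cos θ` turns semicircle integrals into trigonometric ones. -/
lemma integral_semicircleDensity_mul {t : ℝ} (ht : 0 < t) (F : ℝ → ℝ) :
    ∫ x, semicircleDensity t x * F x =
      2 / Real.pi * ∫ θ in 0..Real.pi, Real.sin θ ^ 2 * F (2 * √t * Real.cos θ) := by
  set r := √t with hr
  have hr0 : 0 < r := Real.sqrt_pos.2 ht
  have hrt : r ^ 2 = t := Real.sq_sqrt ht.le
  have h1 : ∫ x, semicircleDensity t x * F x =
      ∫ x in (2 * r * (-1))..(2 * r * 1), √(4 * t - x ^ 2) / (2 * Real.pi * t) * F x := by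
    rw [intervalIntegral.integral_of_le (by linarith), ← integral_Icc_eq_integral_Ioc,
      ← integral_indicator measurableSet_Icc]
    congr 1 with x
    simp only [semicircleDensity, Set.indicator, Set.mem_Icc, abs_le, mul_neg, mul_one, ← hr]
    split_ifs <;> simp
  simp only [Real.sin_sq]
  rw [← Polynomial.Chebyshev.integral_measureT_eq_integral_cos
      (f := fun y => (1 - y ^ 2) * F (2 * r * y)),
    Polynomial.Chebyshev.integral_measureT, h1,
    ← intervalIntegral.mul_integral_comp_mul_left, ← intervalIntegral.integral_const_mul,
    ← intervalIntegral.integral_const_mul]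
  refine intervalIntegral.integral_congr fun y hy => ?_
  rw [Set.uIcc_of_le (by norm_num)] at hy
  have hy' : 0 ≤ 1 - y ^ 2 := by nlinarith [hy.1, hy.2]
  have h3 : √(4 * t - (2 * r * y) ^ 2) = 2 * r * √(1 - y ^ 2) := by
    rw [← hrt, show 4 * r ^ 2 - (2 * r * y) ^ 2 = (2 * r) ^ 2 * (1 - y ^ 2) by ring,
      Real.sqrt_mul (by positivity), Real.sqrt_sq (by positivity)]
  -- `w ^ 2 * w⁻¹ = w` holds also at the end points, where the junk inverse of `0` is `0`.
  have h4 : (1 - y ^ 2) * √(1 - y ^ 2)⁻¹ = √(1 - y ^ 2) := by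
    rw [Real.sqrt_inv]
    nth_rewrite 1 [← Real.mul_self_sqrt hy']
    exact mul_self_mul_inv _
  rw [h3, ← h4, ← hrt]
  field_simp

lemma integral_sin_mul_sin (j k : ℕ) :
    ∫ θ in 0..Real.pi, Real.sin ((j + 1) * θ) * Real.sin ((k + 1) * θ) =
      if j = k then Real.pi / 2 else 0 := by
  have hT (n : ℤ) : ∫ θ in 0..Real.pi, Real.cos (n * θ) = if n = 0 then Real.pi else 0 := by
    simp only [← Polynomial.Chebyshev.T_real_cos]
    rw [← Polynomial.Chebyshev.integral_measureT_eq_integral_cos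
      (f := fun x => (Polynomial.Chebyshev.T ℝ n).eval x)]
    split_ifs with hn
    · rw [hn]; exact Polynomial.Chebyshev.integral_eval_T_real_measureT_zero
    · exact Polynomial.Chebyshev.integral_eval_T_real_measureT_of_ne_zero hn
  have h (θ : ℝ) : Real.sin ((j + 1) * θ) * Real.sin ((k + 1) * θ) =
      (Real.cos (((j - k : ℤ) : ℝ) * θ) - Real.cos (((j + k + 2 : ℤ) : ℝ) * θ)) / 2 := by
    have h1 : ((j - k : ℤ) : ℝ) * θ = (j + 1) * θ - (k + 1) * θ := by push_cast; ring
    have h2 : ((j + k + 2 : ℤ) : ℝ) * θ = (j + 1) * θ + (k + 1) * θ := by push_cast; ring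
    rw [h1, h2, Real.cos_sub, Real.cos_add]
    ring
  simp only [h]
  rw [intervalIntegral.integral_div, intervalIntegral.integral_sub
    (Continuous.intervalIntegrable (by fun_prop) _ _)
    (Continuous.intervalIntegrable (by fun_prop) _ _), hT, hT,
    if_neg (show (j + k + 2 : ℤ) ≠ 0 by omega)]
  by_cases hjk : j = k
  · simp [hjk]
  · rw [if_neg (by omega), if_neg hjk]; simp

lemma integral_semicircleDensity_mul_freeChebyshev {t : ℝ} (ht : 0 < t) (j k : ℕ) :
    ∫ x, semicircleDensity t x * (freeChebyshev t x j * freeChebyshev t x k) =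
      if j = k then t ^ k else 0 := by
  have hr (θ : ℝ) (n : ℕ) : Real.sin θ * freeChebyshev t (2 * √t * Real.cos θ) n =
      √t ^ n * Real.sin ((n + 1) * θ) := by
    have h := freeChebyshev_eq_eval_U (√t) (Real.cos θ) n
    have h' := Polynomial.Chebyshev.U_real_cos θ n
    push_cast at h'
    rw [Real.sq_sqrt ht.le] at h
    rw [h, ← h']
    ring
  rw [integral_semicircleDensity_mul ht]
  have h (θ : ℝ) : Real.sin θ ^ 2 * (freeChebyshev t (2 * √t * Real.cos θ) j *
      freeChebyshev t (2 * √t * Real.cos θ) k) =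
      √t ^ (j + k) * (Real.sin ((j + 1) * θ) * Real.sin ((k + 1) * θ)) := by
    linear_combination (Real.sin θ * freeChebyshev t (2 * √t * Real.cos θ) k) * hr θ j +
      √t ^ j * Real.sin ((j + 1) * θ) * hr θ k
  simp only [h]
  rw [intervalIntegral.integral_const_mul, integral_sin_mul_sin]
  split_ifs with hjk
  · subst hjk
    rw [← two_mul, pow_mul, Real.sq_sqrt ht.le]
    field_simp
  · simp

/-! ### The transition density as a bilinear series -/

lemma abs_freeChebyshev_mul_le {s t x y : ℝ} (hs : 0 ≤ s) (hst : s < t) (hx : |x| ≤ 2 * √s)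
    (hy : |y| ≤ 2 * √t) (i j k : ℕ) :
    |freeChebyshev s x (k + i) * freeChebyshev t y (k + j) / t ^ k| ≤
      ((i + 1) * √s ^ i * ((j + 1) * √t ^ j)) * ((k + 1) ^ 2 * (√s / √t) ^ k) := by
  have ht : 0 < t := hs.trans_lt hst
  have ht' : 0 < √t := Real.sqrt_pos.2 ht
  have h1 : |freeChebyshev s x (k + i)| ≤ (k + 1) * (i + 1) * √s ^ (k + i) := by
    refine (abs_freeChebyshev_le hs hx _).trans ?_
    push_cast
    gcongr
    nlinarith [show (0 : ℝ) ≤ k * i by positivity]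
  have h2 : |freeChebyshev t y (k + j)| ≤ (k + 1) * (j + 1) * √t ^ (k + j) := by
    refine (abs_freeChebyshev_le ht.le hy _).trans ?_
    push_cast
    gcongr
    nlinarith [show (0 : ℝ) ≤ k * j by positivity]
  rw [abs_div, abs_mul, abs_of_pos (pow_pos ht k), div_le_iff₀ (pow_pos ht k)]
  refine (mul_le_mul h1 h2 (abs_nonneg _) (by positivity)).trans_eq ?_
  have h3 : t ^ k = √t ^ k * √t ^ k := by rw [← mul_pow, Real.mul_self_sqrt ht.le]
  rw [h3, div_pow]
  field_simp
  ring

lemma summable_add_one_sq_mul_pow {q : ℝ} (hq₀ : 0 ≤ q) (hq : q < 1) :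
    Summable fun k : ℕ => ((k : ℝ) + 1) ^ 2 * q ^ k := by
  have h (m : ℕ) : Summable fun k : ℕ => (k : ℝ) ^ m * q ^ k :=
    summable_pow_mul_geometric_of_norm_lt_one m (by rwa [Real.norm_of_nonneg hq₀])
  refine (((h 2).add ((h 1).mul_left 2)).add (h 0)).congr fun k => ?_
  ring

lemma sqrt_div_sqrt_lt_one {s t : ℝ} (hs : 0 ≤ s) (hst : s < t) : √s / √t < 1 :=
  (div_lt_one (Real.sqrt_pos.2 (hs.trans_lt hst))).2 (Real.sqrt_lt_sqrt hs hst)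

lemma summable_freeChebyshev_mul {s t x y : ℝ} (hs : 0 ≤ s) (hst : s < t) (hx : |x| ≤ 2 * √s)
    (hy : |y| ≤ 2 * √t) (i j : ℕ) :
    Summable fun k => freeChebyshev s x (k + i) * freeChebyshev t y (k + j) / t ^ k :=
  .of_norm_bounded ((summable_add_one_sq_mul_pow (by positivity)
    (sqrt_div_sqrt_lt_one hs hst)).mul_left _)
    fun k => abs_freeChebyshev_mul_le hs hst hx hy i j k

/-- A Poisson–Mehler formula: the bilinear generating series of the polynomials is a rational
function. Both three-term recurrences give linear relations between the shifted series
`G i j = ∑ a_{k+i} b_{k+j} / t ^ k`, and eliminating all but `G 0 0` yields the identity. -/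
lemma mul_tsum_freeChebyshev_mul {s t x y : ℝ} (hs : 0 ≤ s) (hst : s < t) (hx : |x| ≤ 2 * √s)
    (hy : |y| ≤ 2 * √t) :
    (t * x ^ 2 + s * y ^ 2 - (s + t) * x * y + (t - s) ^ 2) *
      ∑' k, freeChebyshev s x k * freeChebyshev t y k / t ^ k = t * (t - s) := by
  have ht : t ≠ 0 := (hs.trans_lt hst).ne'
  set G : ℕ → ℕ → ℝ := fun i j =>
    ∑' k, freeChebyshev s x (k + i) * freeChebyshev t y (k + j) / t ^ k with hG
  have hsum := summable_freeChebyshev_mul hs hst hx hy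
  have hshift (i j : ℕ) :
      G i j = freeChebyshev s x i * freeChebyshev t y j + G (i + 1) (j + 1) / t := by
    rw [hG]
    simp only
    rw [(hsum i j).tsum_eq_zero_add, ← tsum_div_const]
    congr 1
    · simp
    · refine tsum_congr fun k => ?_
      rw [add_right_comm k 1 i, add_right_comm k 1 j, pow_succ]
      field_simp
      simp only [add_assoc]
  have hleft (i j : ℕ) : G (i + 2) j = x * G (i + 1) j - s * G i j := by
    rw [hG]
    simp only
    rw [← tsum_mul_left, ← tsum_mul_left,
      ← ((hsum _ _).mul_left x).tsum_sub ((hsum _ _).mul_left s)]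
    refine tsum_congr fun k => ?_
    rw [← add_assoc k i 2, ← add_assoc k i 1, freeChebyshev_add_two]
    ring
  have hright (i j : ℕ) : G i (j + 2) = y * G i (j + 1) - t * G i j := by
    rw [hG]
    simp only
    rw [← tsum_mul_left, ← tsum_mul_left,
      ← ((hsum _ _).mul_left y).tsum_sub ((hsum _ _).mul_left t)]
    refine tsum_congr fun k => ?_
    rw [← add_assoc k j 2, ← add_assoc k j 1, freeChebyshev_add_two]
    ring
  have h00 := hshift 0 0
  have h10 := hshift 1 0
  have h01 := hshift 0 1
  have h11 := hshift 1 1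
  rw [hleft 0 1] at h10
  rw [hright 1 0] at h01
  rw [hleft 0 2, hright 0 0, hright 1 0] at h11
  simp only [zero_add, freeChebyshev, mul_one, one_mul] at h00 h10 h01 h11
  have hA : t * G 0 0 = t + G 1 1 := by
    rw [h00]; field_simp
  have hY : G 0 1 = y * G 0 0 - G 1 0 := by
    have h : t * G 0 1 = t * y + (y * G 1 1 - t * G 1 0) := by
      nth_rewrite 1 [h01]; field_simp
    exact mul_left_cancel₀ ht (by linear_combination h - y * hA)
  have hX : (t - s) * G 1 0 = (t * x - s * y) * G 0 0 := by
    have h : t * G 1 0 = t * x + (x * G 1 1 - s * G 0 1) := by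
      nth_rewrite 1 [h10]; field_simp
    linear_combination h - x * hA - s * hY
  have hT : t * G 1 1 = (t * x - s * y) * G 0 1 + s * t * G 0 0 := by
    have h : t * G 1 1 = t * x * y +
        (x * (y * G 1 1 - t * G 1 0) - s * (y * G 0 1 - t * G 0 0)) := by
      nth_rewrite 1 [h11]; field_simp
    linear_combination h - x * y * hA - t * x * hY
  change _ * G 0 0 = _
  exact mul_left_cancel₀ ht (by
    linear_combination (t - s) * hT + (t - s) * t * hA + (t * x - s * y) * (t - s) * hY -
      (t * x - s * y) * hX)

lemma freeTransitionDensity_eq_semicircleDensity_mul_tsum {s t x : ℝ} (hs : 0 ≤ s) (hst : s < t)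
    (hx : |x| ≤ 2 * √s) (y : ℝ) :
    freeTransitionDensity s t x y = semicircleDensity t y *
      ∑' k, freeChebyshev s x k * freeChebyshev t y k / t ^ k := by
  have ht : t ≠ 0 := (hs.trans_lt hst).ne'
  have hts : t - s ≠ 0 := (sub_pos.2 hst).ne'
  by_cases hy : |y| ≤ 2 * √t
  · have h := mul_tsum_freeChebyshev_mul hs hst hx hy
    rw [freeTransitionDensity, semicircleDensity, if_pos ⟨hx, hy⟩, if_pos hy]
    set D := t * x ^ 2 + s * y ^ 2 - (s + t) * x * y + (t - s) ^ 2
    have hD : D ≠ 0 := left_ne_zero_of_mul (h.trans_ne (mul_ne_zero ht hts))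
    rw [eq_div_of_mul_eq hD ((mul_comm _ _).trans h)]
    field_simp
  · rw [freeTransitionDensity, semicircleDensity, if_neg (fun h => hy h.2), if_neg hy, zero_mul]

/-- The denominator `D` is nonnegative because
`4 * s * D = (2 * s * y - (s + t) * x) ^ 2 + (t - s) ^ 2 * (4 * s - x ^ 2)`. -/
lemma freeTransitionDensity_nonneg {s t : ℝ} (hs : 0 < s) (hst : s < t) (x y : ℝ) :
    0 ≤ freeTransitionDensity s t x y := by
  rw [freeTransitionDensity]
  split_ifs with h
  · have hx : x ^ 2 ≤ 4 * s := by
      have := sq_le_sq' (by linarith [neg_abs_le x, h.1]) ((le_abs_self x).trans h.1)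
      rwa [mul_pow, Real.sq_sqrt hs.le, show (2 : ℝ) ^ 2 = 4 by norm_num] at this
    have hD : 0 ≤ t * x ^ 2 + s * y ^ 2 - (s + t) * x * y + (t - s) ^ 2 := by
      refine nonneg_of_mul_nonneg_right (a := 4 * s) ?_ (by positivity)
      nlinarith [sq_nonneg (2 * s * y - (s + t) * x),
        mul_nonneg (sq_nonneg (t - s)) (sub_nonneg.2 hx)]
    have := sub_pos.2 hst
    positivity
  · exact le_rfl

lemma semicircleDensity_nonneg {t : ℝ} (ht : 0 ≤ t) (x : ℝ) : 0 ≤ semicircleDensity t x := by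
  rw [semicircleDensity]
  split_ifs <;> positivity

lemma integrable_semicircleDensity_mul (t : ℝ) {F : ℝ → ℝ}
    (hF : ContinuousOn F (Set.Icc (-(2 * √t)) (2 * √t))) :
    Integrable fun x => semicircleDensity t x * F x := by
  have h : (fun x => semicircleDensity t x * F x) =
      (Set.Icc (-(2 * √t)) (2 * √t)).indicator
        fun x => √(4 * t - x ^ 2) / (2 * Real.pi * t) * F x := by
    ext x
    simp only [semicircleDensity, Set.indicator, Set.mem_Icc, abs_le]
    split_ifs <;> simp
  rw [h, integrable_indicator_iff measurableSet_Icc]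
  refine ContinuousOn.integrableOn_Icc (ContinuousOn.mul ?_ hF)
  exact Continuous.continuousOn (by fun_prop)

lemma integrable_freeTransitionDensity {s t x : ℝ} (hs : 0 ≤ s) (hst : s < t)
    (hx : |x| ≤ 2 * √s) : Integrable (freeTransitionDensity s t x) := by
  have h : freeTransitionDensity s t x = fun y => semicircleDensity t y *
      ∑' k, freeChebyshev s x k * freeChebyshev t y k / t ^ k :=
    funext (freeTransitionDensity_eq_semicircleDensity_mul_tsum hs hst hx)
  rw [h]
  refine integrable_semicircleDensity_mul t ?_
  refine continuousOn_tsum (fun k => ?_) ((summable_add_one_sq_mul_pow (by positivity)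
    (sqrt_div_sqrt_lt_one hs hst)).mul_left _)
    fun k y hy => abs_freeChebyshev_mul_le hs hst hx (abs_le.2 hy) 0 0 k
  exact (((continuous_freeChebyshev t k).const_mul _).div_const _).continuousOn

/-- The transition densities map the orthogonal polynomials of time `t` to those of time `s`. -/
theorem integral_freeTransitionDensity_mul_freeChebyshev {s t x : ℝ} (hs : 0 ≤ s) (hst : s < t)
    (hx : |x| ≤ 2 * √s) (k : ℕ) :
    ∫ y, freeTransitionDensity s t x y * freeChebyshev t y k = freeChebyshev s x k := by
  have ht : 0 < t := hs.trans_lt hst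
  set q := √s / √t
  have hsumm := summable_add_one_sq_mul_pow (q := q) (by positivity) (sqrt_div_sqrt_lt_one hs hst)
  set F : ℕ → ℝ → ℝ := fun i y => freeChebyshev s x i / t ^ i *
    (semicircleDensity t y * (freeChebyshev t y i * freeChebyshev t y k)) with hF
  have hint (i : ℕ) : ∫ y, F i y = if i = k then freeChebyshev s x k else 0 := by
    rw [hF]
    simp only
    rw [integral_const_mul, integral_semicircleDensity_mul_freeChebyshev ht]
    split_ifs with h
    · subst h
      have := pow_pos ht i
      field_simp
    · simp
  have hsum : HasSum (fun i => ∫ y, F i y)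
      (∫ y, freeTransitionDensity s t x y * freeChebyshev t y k) := by
    refine hasSum_integral_of_dominated_convergence
      (fun i y => ((i + 1) ^ 2 * q ^ i) * (semicircleDensity t y * |freeChebyshev t y k|))
      (fun i => ?_) (fun i => ae_of_all _ fun y => ?_) (ae_of_all _ fun y => ?_) ?_
      (ae_of_all _ fun y => ?_)
    · refine Integrable.aestronglyMeasurable ((integrable_semicircleDensity_mul t ?_).const_mul _)
      exact ((continuous_freeChebyshev t i).mul (continuous_freeChebyshev t k)).continuousOn
    · by_cases hy : |y| ≤ 2 * √t
      · have h := abs_freeChebyshev_mul_le hs hst hx hy 0 0 i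
        simp only [Nat.cast_zero, zero_add, pow_zero, mul_one, one_mul, add_zero] at h
        have h' : F i y = (freeChebyshev s x i * freeChebyshev t y i / t ^ i) *
            (semicircleDensity t y * freeChebyshev t y k) := by
          rw [hF]; ring
        rw [h', norm_mul, norm_mul, Real.norm_of_nonneg (semicircleDensity_nonneg ht.le y),
          Real.norm_eq_abs, Real.norm_eq_abs]
        exact mul_le_mul_of_nonneg_right h
          (mul_nonneg (semicircleDensity_nonneg ht.le y) (abs_nonneg _))
      · simp [hF, semicircleDensity, hy]
    · exact hsumm.mul_right _
    · simp only [tsum_mul_right]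
      refine (integrable_semicircleDensity_mul t ?_).const_mul _
      exact (continuous_freeChebyshev t k).abs.continuousOn
    · by_cases hy : |y| ≤ 2 * √t
      · have h := (summable_freeChebyshev_mul hs hst hx hy 0 0).hasSum.mul_left
          (semicircleDensity t y * freeChebyshev t y k)
        simp only [add_zero] at h
        rw [freeTransitionDensity_eq_semicircleDensity_mul_tsum hs hst hx, mul_right_comm]
        rwa [show (fun i => F i y) = fun i => semicircleDensity t y * freeChebyshev t y k *
          (freeChebyshev s x i * freeChebyshev t y i / t ^ i) by ext i; rw [hF]; ring]
      · have h0 : semicircleDensity t y = 0 := by simp [semicircleDensity, hy]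
        simp only [hF, freeTransitionDensity_eq_semicircleDensity_mul_tsum hs hst hx, h0, zero_mul,
          mul_zero]
        exact hasSum_zero
  simp only [hint] at hsum
  exact hsum.unique (hasSum_ite_eq k _)

/-! ### Nonnegative lattice paths -/

/-- The nonnegative lattice paths from `(0, 0)` to `(n, h)`, recorded by their increments in
`{-1, 0, 1}`; for `h = 0` these are the Motzkin paths. -/
def motzkinPathsTo (n : ℕ) (h : ℤ) : Finset (Fin n → ℤ) :=
  {ε ∈ Fintype.piFinset fun _ : Fin n => ({-1, 0, 1} : Finset ℤ) |
    (∀ k : Fin (n + 1), 0 ≤ ∑ j : Fin n with j.val < k.val, ε j) ∧ ∑ j, ε j = h}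

lemma motzkinPathsTo_eq_empty (n : ℕ) {h : ℤ} (hh : h < 0) : motzkinPathsTo n h = ∅ := by
  ext ε
  simp only [motzkinPathsTo, Finset.mem_filter, Finset.notMem_empty, iff_false, not_and]
  intro _ h1 h2
  have := h1 (Fin.last n)
  simp [h2] at this
  omega

lemma mem_motzkinPathsTo_succ {n : ℕ} {h : ℤ} (hh : 0 ≤ h) (ε : Fin (n + 1) → ℤ) :
    ε ∈ motzkinPathsTo (n + 1) h ↔ ε (Fin.last n) ∈ ({-1, 0, 1} : Finset ℤ) ∧
      Fin.init ε ∈ motzkinPathsTo n (h - ε (Fin.last n)) := by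
  have hprefix (k : Fin (n + 1)) : ∑ j : Fin (n + 1) with j.val < k.castSucc.val, ε j =
      ∑ j : Fin n with j.val < k.val, Fin.init ε j := by
    have hk : ¬ n < k.val := by omega
    simp only [Finset.sum_filter, Fin.sum_univ_castSucc, Fin.init, Fin.val_castSucc,
      Fin.val_last, if_neg hk, add_zero]
  have hfull : ∑ j : Fin (n + 1) with j.val < (Fin.last (n + 1)).val, ε j = ∑ j, ε j := by
    simp only [Fin.val_last, Fin.is_lt, Finset.filter_true]
  have htotal : ∑ j, ε j = ∑ j, Fin.init ε j + ε (Fin.last n) := Fin.sum_univ_castSucc ε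
  simp only [motzkinPathsTo, Finset.mem_filter, Fintype.mem_piFinset,
    Fin.forall_fin_succ' (P := fun j => ε j ∈ _), Fin.forall_fin_succ' (n := n + 1), hprefix,
    hfull, htotal, eq_sub_iff_add_eq]
  constructor
  · rintro ⟨⟨h1, h2⟩, ⟨h3, -⟩, h5⟩
    exact ⟨h2, h1, h3, h5⟩
  · rintro ⟨h2, h1, h3, h5⟩
    exact ⟨⟨h1, h2⟩, ⟨h3, h5 ▸ hh⟩, h5⟩

/-- The weight of a path: `t j` for an ascent and `u j` for a level step at time `j`. -/
def motzkinWeight {n : ℕ} (t u : Fin n → ℝ) (ε : Fin n → ℤ) : ℝ :=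
  (∏ j, t j ^ (if ε j = 1 then 1 else 0)) * ∏ j, u j ^ (if ε j = 0 then 1 else 0)

/-- The weighted number of nonnegative paths from `(0, 0)` to `(n, h)`. -/
def motzkinSum {n : ℕ} (t u : Fin n → ℝ) (h : ℤ) : ℝ :=
  ∑ ε ∈ motzkinPathsTo n h, motzkinWeight t u ε

lemma motzkinSum_of_neg {n : ℕ} (t u : Fin n → ℝ) {h : ℤ} (hh : h < 0) :
    motzkinSum t u h = 0 := by
  rw [motzkinSum, motzkinPathsTo_eq_empty n hh, Finset.sum_empty]

lemma motzkinSum_zero (t u : Fin 0 → ℝ) (k : ℕ) :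
    motzkinSum t u k = if k = 0 then 1 else 0 := by
  by_cases hk : k = 0
  · simp [motzkinSum, motzkinPathsTo, motzkinWeight, hk]
  · simp [motzkinSum, motzkinPathsTo, motzkinWeight, hk, eq_comm]

/-- Decomposition of the paths according to their last step. -/
lemma motzkinSum_succ {n : ℕ} (t u : Fin (n + 1) → ℝ) (k : ℕ) :
    motzkinSum t u k = motzkinSum (Fin.init t) (Fin.init u) (k + 1) +
      u (Fin.last n) * motzkinSum (Fin.init t) (Fin.init u) k +
      t (Fin.last n) * motzkinSum (Fin.init t) (Fin.init u) (k - 1) := by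
  have h : motzkinSum t u k = ∑ e ∈ ({-1, 0, 1} : Finset ℤ),
      ∑ ε ∈ motzkinPathsTo n (k - e), motzkinWeight t u (Fin.snoc ε e) := by
    rw [motzkinSum, Finset.sum_sigma']
    refine Finset.sum_bij' (fun ε _ => ⟨ε (Fin.last n), Fin.init ε⟩)
      (fun p _ => Fin.snoc p.2 p.1) ?_ ?_ ?_ ?_ ?_
    · intro ε hε
      exact Finset.mem_sigma.2 ((mem_motzkinPathsTo_succ (by positivity) ε).1 hε)
    · intro p hp
      refine (mem_motzkinPathsTo_succ (by positivity) _).2 ?_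
      simpa using Finset.mem_sigma.1 hp
    · intro ε _; simp
    · intro p _; simp
    · intro ε _; simp
  rw [h]
  simp only [Finset.mem_insert, Finset.mem_singleton, reduceCtorEq, or_self, not_false_eq_true,
    Finset.sum_insert, Finset.sum_singleton, motzkinSum, motzkinWeight, Fin.prod_univ_castSucc,
    Finset.mul_sum, Fin.init, Fin.snoc_castSucc, Fin.snoc_last, neg_eq_zero, one_ne_zero,
    zero_ne_one, sub_neg_eq_add, sub_zero, ← add_assoc]
  norm_num
  congr 1
  · congr 1
    exact Finset.sum_congr rfl fun ε _ => by ring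
  · exact Finset.sum_congr rfl fun ε _ => by ring

/-! ### The transition kernel and the martingale property -/

lemma measurable_uncurry_freeTransitionDensity (s t : ℝ) :
    Measurable (Function.uncurry (freeTransitionDensity s t)) := by
  unfold freeTransitionDensity Function.uncurry
  refine Measurable.ite (MeasurableSet.inter (s₁ := {p : ℝ × ℝ | |p.1| ≤ 2 * √s})
    (s₂ := {p : ℝ × ℝ | |p.2| ≤ 2 * √t}) ?_ ?_) (by fun_prop) measurable_const
  · exact measurableSet_le (by fun_prop) measurable_const
  · exact measurableSet_le (by fun_prop) measurable_const

/-- The transition kernel from time `s` to time `t` of the free Brownian motion. Its mass is one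
only at the points `|x| ≤ 2√s`; elsewhere the kernel vanishes. -/
noncomputable def freeTransitionKernel (s t : ℝ) : Kernel ℝ ℝ :=
  Kernel.withDensity (Kernel.const ℝ volume) fun x y =>
    ((freeTransitionDensity s t x y).toNNReal : ENNReal)

instance (s t : ℝ) : IsSFiniteKernel (freeTransitionKernel s t) := by
  unfold freeTransitionKernel; infer_instance

lemma integral_freeTransitionKernel {s t : ℝ} (hs : 0 < s) (hst : s < t) (x : ℝ) (f : ℝ → ℝ) :
    ∫ y, f y ∂freeTransitionKernel s t x = ∫ y, freeTransitionDensity s t x y * f y := by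
  rw [freeTransitionKernel, Kernel.integral_withDensity
    (measurable_uncurry_freeTransitionDensity s t).real_toNNReal, Kernel.const_apply]
  refine integral_congr_ae (ae_of_all _ fun y => ?_)
  simp only [NNReal.smul_def, smul_eq_mul,
    Real.coe_toNNReal _ (freeTransitionDensity_nonneg hs hst x y)]

lemma freeTransitionKernel_apply {s t x : ℝ} (hs : 0 < s) (hst : s < t) (hx : |x| ≤ 2 * √s)
    (B : Set ℝ) :
    freeTransitionKernel s t x B = ENNReal.ofReal (∫ y in B, freeTransitionDensity s t x y) := by
  rw [freeTransitionKernel, Kernel.withDensity_apply' _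
    (measurable_uncurry_freeTransitionDensity s t).real_toNNReal.coe_nnreal_ennreal,
    Kernel.const_apply, ofReal_integral_eq_lintegral_ofReal
      (integrable_freeTransitionDensity hs.le hst hx).integrableOn
      (ae_of_all _ fun y => freeTransitionDensity_nonneg hs hst x y)]
  rfl

namespace IsFreeBrownianMotion

/-- The `σ`-algebra generated by the process up to time `s`. -/
abbrev past {Ω : Type*} (Z : ℝ≥0 → Ω → ℝ) (s : ℝ≥0) : MeasurableSpace Ω :=
  ⨆ r : ℝ≥0, ⨆ _ : r ≤ s, MeasurableSpace.comap (Z r) inferInstance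

lemma measurable_past {Ω : Type*} {Z : ℝ≥0 → Ω → ℝ} {r s : ℝ≥0} (h : r ≤ s) :
    Measurable[past Z s] (Z r) :=
  (comap_measurable (Z r)).mono (le_iSup₂_of_le r h le_rfl) le_rfl

variable {Ω : Type*} [MeasurableSpace Ω] {P : Measure Ω} {Z : ℝ≥0 → Ω → ℝ}

lemma past_le (hZ : IsFreeBrownianMotion Z P) (s : ℝ≥0) : past Z s ≤ ‹MeasurableSpace Ω› :=
  iSup₂_le fun r _ => (hZ.measurable r).comap_le

/-- Semicircle marginals make `Z t` almost surely bounded, so that integrability is automatic. -/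
lemma ae_abs_le (hZ : IsFreeBrownianMotion Z P) {t : ℝ≥0} (ht : 0 < t) :
    ∀ᵐ ω ∂P, |Z t ω| ≤ 2 * √(t : ℝ) := by
  have hm : MeasurableSet {x : ℝ | |x| ≤ 2 * √(t : ℝ)} :=
    measurableSet_le (by fun_prop) measurable_const
  rw [← ae_map_iff (p := fun x => |x| ≤ 2 * √(t : ℝ)) (hZ.measurable t).aemeasurable hm,
    hZ.marginal t ht, ae_iff, withDensity_apply' , ← nonpos_iff_eq_zero]
  refine (setLIntegral_mono' hm.compl (g := fun _ => 0) fun x hx => ?_).trans (by simp)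
  have hx : ¬ |x| ≤ 2 * √(t : ℝ) := hx
  simp [semicircleDensity, hx]

lemma integral_comp (hZ : IsFreeBrownianMotion Z P) {t : ℝ≥0} (ht : 0 < t) {f : ℝ → ℝ}
    (hf : Measurable f) : ∫ ω, f (Z t ω) ∂P = ∫ x, semicircleDensity t x * f x := by
  have hm : Measurable (semicircleDensity t) := by
    unfold semicircleDensity
    exact Measurable.ite (measurableSet_le (by fun_prop) measurable_const) (by fun_prop)
      measurable_const
  rw [← integral_map (hZ.measurable t).aemeasurable hf.aestronglyMeasurable, hZ.marginal t ht]
  refine (integral_withDensity_eq_integral_smul hm.real_toNNReal f).trans ?_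
  refine integral_congr_ae (ae_of_all _ fun x => ?_)
  simp only [NNReal.smul_def, smul_eq_mul,
    Real.coe_toNNReal _ (semicircleDensity_nonneg t.coe_nonneg x)]

lemma integral_freeChebyshev (hZ : IsFreeBrownianMotion Z P) {t : ℝ≥0} (ht : 0 < t) (k : ℕ) :
    ∫ ω, freeChebyshev t (Z t ω) k ∂P = if k = 0 then 1 else 0 := by
  have h := integral_semicircleDensity_mul_freeChebyshev (NNReal.coe_pos.2 ht) k 0
  rw [hZ.integral_comp ht (continuous_freeChebyshev t k).measurable]
  simpa [freeChebyshev] using h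

lemma ae_abs_prod_le (hZ : IsFreeBrownianMotion Z P) {n : ℕ} {t : Fin n → ℝ≥0}
    (ht_pos : ∀ j, 0 < t j) (u : Fin n → ℝ) :
    ∀ᵐ ω ∂P, |∏ j, (u j + Z (t j) ω)| ≤ ∏ j, (|u j| + 2 * √(t j : ℝ)) := by
  filter_upwards [ae_all_iff.2 fun j => hZ.ae_abs_le (ht_pos j)] with ω h
  rw [Finset.abs_prod]
  exact Finset.prod_le_prod (fun _ _ => abs_nonneg _) fun j _ =>
    (abs_add_le _ _).trans (by gcongr; exact h j)

lemma measurable_prod (hZ : IsFreeBrownianMotion Z P) {n : ℕ} (t : Fin n → ℝ≥0)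
    (u : Fin n → ℝ) : Measurable fun ω => ∏ j, (u j + Z (t j) ω) :=
  Finset.measurable_prod _ fun j _ => (hZ.measurable (t j)).const_add (u j)

variable [IsProbabilityMeasure P]

/-- The Markov property as an identity of measures, on each event of the past. -/
lemma map_restrict_eq_bind (hZ : IsFreeBrownianMotion Z P) {s t : ℝ≥0} (hs : 0 < s) (hst : s < t)
    {A : Set Ω} (hA : MeasurableSet[past Z s] A) :
    (P.restrict A).map (Z t) =
      ((P.restrict A).map (Z s)).bind (freeTransitionKernel s t) := by
  have hs' : (0 : ℝ) < s := hs
  have hst' : (s : ℝ) < t := hst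
  have hle := hZ.past_le s
  ext B hB
  have hint : Integrable ((Z t ⁻¹' B).indicator fun _ => (1 : ℝ)) P :=
    (integrable_const 1).indicator (hZ.measurable t hB)
  have hZB := hZ.markov s t hst B hB
  rw [Measure.map_apply (hZ.measurable t) hB, Measure.bind_apply hB (Kernel.aemeasurable _),
    lintegral_map (Kernel.measurable_coe _ hB) (hZ.measurable s)]
  have h1 : ∫⁻ ω in A, freeTransitionKernel s t (Z s ω) B ∂P =
      ∫⁻ ω in A, ENNReal.ofReal
        (P[(Z t ⁻¹' B).indicator (fun _ => (1 : ℝ)) | past Z s] ω) ∂P := by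
    refine lintegral_congr_ae (ae_restrict_of_ae ?_)
    filter_upwards [hZB, hZ.ae_abs_le hs] with ω h1 h2
    rw [h1, freeTransitionKernel_apply hs' hst' h2]
  rw [h1, ← ofReal_integral_eq_lintegral_ofReal integrable_condExp.integrableOn
      (ae_restrict_of_ae (condExp_nonneg (ae_of_all _ fun ω =>
        Set.indicator_nonneg (fun _ _ => zero_le_one) ω))),
    setIntegral_condExp hle hint hA, integral_indicator (hZ.measurable t hB),
    setIntegral_const, smul_eq_mul, mul_one, ofReal_measureReal]

lemma integrable_freeChebyshev (hZ : IsFreeBrownianMotion Z P) {t : ℝ≥0} (ht : 0 < t) (k : ℕ) :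
    Integrable (fun ω => freeChebyshev t (Z t ω) k) P := by
  refine .of_bound ((continuous_freeChebyshev t k).measurable.comp
    (hZ.measurable t)).aestronglyMeasurable ((k + 1) * √(t : ℝ) ^ k) ?_
  filter_upwards [hZ.ae_abs_le ht] with ω h using abs_freeChebyshev_le t.coe_nonneg h k

/-- Along a free Brownian motion the orthogonal polynomials are martingales. -/
theorem condExp_freeChebyshev (hZ : IsFreeBrownianMotion Z P) {s t : ℝ≥0} (hs : 0 < s)
    (hst : s < t) (k : ℕ) :
    P[fun ω => freeChebyshev t (Z t ω) k | past Z s] =ᵐ[P]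
      fun ω => freeChebyshev s (Z s ω) k := by
  symm
  have hct := (continuous_freeChebyshev t k).measurable
  refine ae_eq_condExp_of_forall_setIntegral_eq (hZ.past_le s) (hZ.integrable_freeChebyshev
    (hs.trans hst) k) (fun _ _ _ => (hZ.integrable_freeChebyshev hs k).integrableOn)
    (fun A hA _ => ?_) ((continuous_freeChebyshev s k).measurable.comp
      (measurable_past le_rfl)).aestronglyMeasurable
  have hint : Integrable (fun y => freeChebyshev t y k) ((P.restrict A).map (Z t)) :=
    (integrable_map_measure hct.aestronglyMeasurable (hZ.measurable t).aemeasurable).2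
      (hZ.integrable_freeChebyshev (hs.trans hst) k).integrableOn
  rw [← integral_map (f := fun y => freeChebyshev t y k) (hZ.measurable t).aemeasurable
    hct.aestronglyMeasurable]
  rw [hZ.map_restrict_eq_bind hs hst hA, Measure.comp_eq_comp_const_apply] at hint ⊢
  rw [Kernel.integral_comp hint, Kernel.const_apply, integral_map (hZ.measurable s).aemeasurable]
  · refine integral_congr_ae (ae_restrict_of_ae ?_)
    filter_upwards [hZ.ae_abs_le hs] with ω h
    rw [integral_freeTransitionKernel (NNReal.coe_pos.2 hs) (NNReal.coe_lt_coe.2 hst),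
      integral_freeTransitionDensity_mul_freeChebyshev s.coe_nonneg (NNReal.coe_lt_coe.2 hst) h]
  · exact (StronglyMeasurable.integral_kernel hct.stronglyMeasurable).aestronglyMeasurable

lemma integral_mul_freeChebyshev (hZ : IsFreeBrownianMotion Z P) {s t : ℝ≥0} (hs : 0 < s)
    (hst : s ≤ t) {Y : Ω → ℝ} (hY : Measurable[past Z s] Y) {C : ℝ}
    (hYC : ∀ᵐ ω ∂P, |Y ω| ≤ C) (k : ℕ) :
    ∫ ω, Y ω * freeChebyshev t (Z t ω) k ∂P = ∫ ω, Y ω * freeChebyshev s (Z s ω) k ∂P := by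
  rcases hst.eq_or_lt with rfl | hst
  · rfl
  · have hi := hZ.integrable_freeChebyshev (hs.trans hst) k
    have hYi : Integrable (Y * fun ω => freeChebyshev t (Z t ω) k) P :=
      hi.bdd_mul (hY.mono (hZ.past_le s) le_rfl).aestronglyMeasurable hYC
    have h1 := condExp_mul_of_stronglyMeasurable_left hY.stronglyMeasurable hYi hi
    refine (integral_condExp (hZ.past_le s)).symm.trans (integral_congr_ae ?_)
    filter_upwards [h1, hZ.condExp_freeChebyshev hs hst k] with ω h1 h2
    exact h1.trans (congrArg (Y ω * ·) h2)

/-! ### Mixed moments and paths -/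

lemma integrable_prod_mul_freeChebyshev (hZ : IsFreeBrownianMotion Z P) {n : ℕ}
    {t : Fin n → ℝ≥0} (ht_pos : ∀ j, 0 < t j) (u : Fin n → ℝ) {T : ℝ≥0} (hT : 0 < T) (k : ℕ) :
    Integrable (fun ω => (∏ j, (u j + Z (t j) ω)) * freeChebyshev T (Z T ω) k) P :=
  (hZ.integrable_freeChebyshev hT k).bdd_mul (hZ.measurable_prod t u).aestronglyMeasurable
    (hZ.ae_abs_prod_le ht_pos u)

/-- The mixed moments against the orthogonal polynomials count paths ending at any height: by the
martingale property the polynomial may be taken at the last time `t (Fin.last n)`, where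
multiplication by `u + x` acts on the polynomials as the last step of a path acts on heights. -/
theorem integral_prod_mul_freeChebyshev (hZ : IsFreeBrownianMotion Z P) {n : ℕ}
    {t : Fin n → ℝ≥0} (ht_pos : ∀ j, 0 < t j) (ht_mono : Monotone t) (u : Fin n → ℝ)
    {T : ℝ≥0} (hT : 0 < T) (htT : ∀ j, t j ≤ T) (k : ℕ) :
    ∫ ω, (∏ j, (u j + Z (t j) ω)) * freeChebyshev T (Z T ω) k ∂P =
      motzkinSum (fun j => (t j : ℝ)) u k := by
  induction n generalizing T k with
  | zero => simp [motzkinSum_zero, hZ.integral_freeChebyshev hT]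
  | succ n ih =>
    have hs := ht_pos (Fin.last n)
    set s := t (Fin.last n) with hs_def
    have hY : Measurable[past Z s] fun ω => ∏ j, (u j + Z (t j) ω) :=
      @Finset.measurable_prod _ _ _ _ _ _ (past Z s) _ _ fun j _ =>
        (measurable_past (ht_mono (Fin.le_last j))).const_add (u j)
    have hpos : ∀ j : Fin n, 0 < t j.castSucc := fun j => ht_pos _
    rw [hZ.integral_mul_freeChebyshev hs (htT _) hY (hZ.ae_abs_prod_le ht_pos u) k,
      motzkinSum_succ]
    have hE (k : ℕ) : ∫ ω, (∏ j : Fin n, (u j.castSucc + Z (t j.castSucc) ω)) *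
        freeChebyshev s (Z s ω) k ∂P =
          motzkinSum (Fin.init fun j => (t j : ℝ)) (Fin.init u) k :=
      ih hpos (ht_mono.comp Fin.strictMono_castSucc.monotone) (fun j => u j.castSucc) hs
        (fun j => ht_mono (Fin.le_last _)) k
    have hI := hZ.integrable_prod_mul_freeChebyshev hpos (fun j => u j.castSucc) hs
    rcases k with _ | k
    · have h1 := motzkinSum_of_neg (Fin.init fun j => (t j : ℝ)) (Fin.init u)
        (show ((0 : ℕ) : ℤ) - 1 < 0 by norm_num)
      have h2 (ω : Ω) : (∏ j, (u j + Z (t j) ω)) * freeChebyshev s (Z s ω) 0 =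
          (∏ j : Fin n, (u j.castSucc + Z (t j.castSucc) ω)) * freeChebyshev s (Z s ω) 1 +
          u (Fin.last n) * ((∏ j : Fin n, (u j.castSucc + Z (t j.castSucc) ω)) *
            freeChebyshev s (Z s ω) 0) := by
        rw [Fin.prod_univ_castSucc, ← hs_def]
        simp only [freeChebyshev]
        ring
      simp only [h2]
      rw [integral_add (hI 1) ((hI 0).const_mul _), integral_const_mul, hE, hE, h1]
      simp
    · have h2 (ω : Ω) : (∏ j, (u j + Z (t j) ω)) * freeChebyshev s (Z s ω) (k + 1) =
          (∏ j : Fin n, (u j.castSucc + Z (t j.castSucc) ω)) * freeChebyshev s (Z s ω) (k + 2) +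
          u (Fin.last n) * ((∏ j : Fin n, (u j.castSucc + Z (t j.castSucc) ω)) *
            freeChebyshev s (Z s ω) (k + 1)) +
          s * ((∏ j : Fin n, (u j.castSucc + Z (t j.castSucc) ω)) *
            freeChebyshev s (Z s ω) k) := by
        rw [Fin.prod_univ_castSucc, ← hs_def, freeChebyshev_add_two]
        ring
      simp only [h2]
      refine (integral_add ((hI (k + 2)).add ((hI (k + 1)).const_mul (u (Fin.last n))))
        ((hI k).const_mul s)).trans ?_
      rw [integral_add' (hI _) ((hI _).const_mul _), integral_const_mul, integral_const_mul, hE,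
        hE, hE]
      push_cast
      rw [add_sub_cancel_right, add_assoc (k : ℤ) 1 1, one_add_one_eq_two]

end IsFreeBrownianMotion

/-- For `0 < t₁ ≤ ⋯ ≤ tₙ`, the joint generating function of the ascents and the level steps of
Motzkin paths is a joint moment of the free Brownian motion. -/
theorem proposition3 {Ω : Type*} [MeasurableSpace Ω] (P : Measure Ω) [IsProbabilityMeasure P]
    (Z : ℝ≥0 → Ω → ℝ) (hZ : IsFreeBrownianMotion Z P)
    (n : ℕ) (t : Fin n → ℝ≥0) (ht_pos : ∀ j, 0 < t j) (ht_mono : Monotone t)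
    (u : Fin n → ℝ) :
    Integrable (fun ω => ∏ j, (u j + Z (t j) ω)) P ∧
      ∑ ε ∈ motzkinPaths n,
          (∏ j, (t j : ℝ) ^ (if ε j = 1 then 1 else 0)) *
            ∏ j, u j ^ (if ε j = 0 then 1 else 0) =
        ∫ ω, ∏ j, (u j + Z (t j) ω) ∂P := by
  refine ⟨.of_bound (hZ.measurable_prod t u).aestronglyMeasurable _
    (hZ.ae_abs_prod_le ht_pos u), ?_⟩
  have h := hZ.integral_prod_mul_freeChebyshev ht_pos ht_mono u (T := 1 + ∑ j, t j)
    (by positivity) (fun j => (Finset.single_le_sum_of_canonicallyOrdered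
      (Finset.mem_univ j)).trans le_add_self) 0
  simp only [freeChebyshev, mul_one] at h
  exact h.symm
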